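/- Let $N\ge 1$, let $V$ be a real symmetric positive definite $N\times N$ matrix, and consider on $L=\mathbb{R}^{2N}$, with points $\psi=(q,p)$, $q,p\in\mathbb{R}^N$, the Hamiltonian $H(\psi)=\frac12\sum_{k=1}^N p_k^2+\frac12\sum_{k,l=1}^N V_{kl}q_kq_l$ and the Hamiltonian system $\dot q=p$, $\dot p=-Vq$, that is, $\dot\psi=A\psi$ with $A=\begin{pmatrix}0&E\\-V&0\end{pmatrix}$. For $h\in\mathbb{R}$ put $\mathcal{M}_h=\{\psi\in L: H(\psi)=h\}$. Let $I:L\to L$ be the velocity flip, which replaces $p_1$ by $-p_1$ and leaves all other coordinates and momenta unchanged, and put $J(t)=Ie^{tA}$ for $t\ge 0$. For $\psi\in L$ and $m\ge 1$ let $$\mathcal{J}_m(\psi)=\{J(\tau_m)\cdots J(\tau_1)\psi:\ \tau_1,\dots,\tau_m\ge 0\}$$ be the set of states reachable at the $m$-th flip. Let $\mathbf{V}^+$ be the set of real symmetric positive definite $N\times N$ matrices $V$ such that $L_-(V)=L$, where $L_-(V)=\{(q,p)\in L: q,p\in l_V\}$ and $l_V\subset\mathbb{R}^N$ is the linear span of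 the vectors $V^ke_1$, $k=0,1,2,\dots$, with $e_1=(1,0,\dots,0)^T$. Let $\mathbf{V}_{ind}$ be the set of real symmetric positive definite $N\times N$ matrices whose eigenvalues $\omega_1^2,\dots,\omega_N^2$ (listed with multiplicity) are linearly independent over $\mathbb{Q}$. **Theorem (covering theorem).** If $V\in\mathbf{V}^+\cap\mathbf{V}_{ind}$, then there exists $m\ge 1$ such that for every $\psi\in L$, $$\mathcal{J}_m(\psi)=\mathcal{M}_{h},\qquad h=H(\psi).$$ The number $m$ depends only on $V$, not on $\psi$ or on its energy $h$. -/

import Mathlib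

open scoped Matrix

namespace VelocityFlip

/-- The phase space `ℝ^{2N}`: the coordinates `q k` are `ψ (Sum.inl k)`, the momenta `p k` are
`ψ (Sum.inr k)`. -/
abbrev Phase (N : ℕ) : Type := Fin N ⊕ Fin N → ℝ

/-- The coordinate part `q` of `ψ = (q, p)`. -/
def qPart {N : ℕ} (ψ : Phase N) : Fin N → ℝ := fun k => ψ (Sum.inl k)

/-- The momentum part `p` of `ψ = (q, p)`. -/
def pPart {N : ℕ} (ψ : Phase N) : Fin N → ℝ := fun k => ψ (Sum.inr k)

/-- The quadratic Hamiltonian `H(q, p) = ∑ p_k² / 2 + (q, V q) / 2`. -/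
noncomputable def energy {N : ℕ} (V : Matrix (Fin N) (Fin N) ℝ) (ψ : Phase N) : ℝ :=
  ∑ k, pPart ψ k ^ 2 / 2 + (1 / 2) * (qPart ψ ⬝ᵥ (V *ᵥ qPart ψ))

/-- The energy surface `M_h = {ψ : H(ψ) = h}`. -/
def energySurface {N : ℕ} (V : Matrix (Fin N) (Fin N) ℝ) (h : ℝ) : Set (Phase N) :=
  {ψ | energy V ψ = h}

/-- The matrix `A = (0, E; -V, 0)` of the Hamiltonian system `q' = p`, `p' = -V q`. -/
def hamMatrix {N : ℕ} (V : Matrix (Fin N) (Fin N) ℝ) :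
    Matrix (Fin N ⊕ Fin N) (Fin N ⊕ Fin N) ℝ :=
  Matrix.fromBlocks 0 1 (-V) 0

/-- The Hamiltonian flow `e^{tA} ψ`. -/
noncomputable def flow {N : ℕ} (V : Matrix (Fin N) (Fin N) ℝ) (t : ℝ) (ψ : Phase N) : Phase N :=
  NormedSpace.exp (t • hamMatrix V) *ᵥ ψ

/-- The velocity flip `I`: the sign of the momentum of the first particle is inverted, all other
coordinates and momenta are unchanged. -/
def flip {N : ℕ} [NeZero N] (ψ : Phase N) : Phase N :=
  Function.update ψ (Sum.inr 0) (-ψ (Sum.inr 0))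

/-- The map `J(t) = I e^{tA}`. -/
noncomputable def flowFlip {N : ℕ} [NeZero N] (V : Matrix (Fin N) (Fin N) ℝ) (t : ℝ)
    (ψ : Phase N) : Phase N :=
  flip (flow V t ψ)

/-- The state `J(τ_m) ⋯ J(τ_1) ψ` right after the `m`-th flip, with waiting times `τ`
(`τ_1` is applied first). -/
noncomputable def stateAtFlip {N : ℕ} [NeZero N] (V : Matrix (Fin N) (Fin N) ℝ) {m : ℕ}
    (τ : Fin m → ℝ) (ψ : Phase N) : Phase N :=
  Fin.foldl m (fun φ i => flowFlip V (τ i) φ) ψ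

/-- The set of states `J(τ_m) ⋯ J(τ_1) ψ`, `τ_1, …, τ_m ≥ 0`, reachable at the `m`-th flip. -/
def reachable {N : ℕ} [NeZero N] (V : Matrix (Fin N) (Fin N) ℝ) (m : ℕ) (ψ : Phase N) :
    Set (Phase N) :=
  {φ | ∃ τ : Fin m → ℝ, (∀ i, 0 ≤ τ i) ∧ stateAtFlip V τ ψ = φ}

/-- The subspace `l_V` of `ℝ^N` generated by `V^k e_1`, `k = 0, 1, 2, …`. -/
def cyclicSubspace {N : ℕ} [NeZero N] (V : Matrix (Fin N) (Fin N) ℝ) :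
    Submodule ℝ (Fin N → ℝ) :=
  Submodule.span ℝ (Set.range fun k : ℕ => (V ^ k) *ᵥ (Pi.single 0 1 : Fin N → ℝ))

/-- The mixing subspace `L_-(V) = {(q, p) : q, p ∈ l_V}` of the phase space. -/
def mixingSubspace {N : ℕ} [NeZero N] (V : Matrix (Fin N) (Fin N) ℝ) :
    Submodule ℝ (Phase N) where
  carrier := {ψ | qPart ψ ∈ cyclicSubspace V ∧ pPart ψ ∈ cyclicSubspace V}
  add_mem' := fun ha hb =>
    ⟨(cyclicSubspace V).add_mem ha.1 hb.1, (cyclicSubspace V).add_mem ha.2 hb.2⟩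
  zero_mem' := ⟨(cyclicSubspace V).zero_mem, (cyclicSubspace V).zero_mem⟩
  smul_mem' := fun c _ h =>
    ⟨(cyclicSubspace V).smul_mem c h.1, (cyclicSubspace V).smul_mem c h.2⟩

/-- The set `V⁺` of the positive definite matrices with `L_-(V)` equal to the whole phase space. -/
def VPlus (N : ℕ) [NeZero N] : Set (Matrix (Fin N) (Fin N) ℝ) :=
  {V | V.PosDef ∧ mixingSubspace V = ⊤}

/-- The set of the positive definite matrices whose eigenvalues `ω_1², …, ω_N²` (listed with
multiplicity) are linearly independent over `ℚ`. -/
def VInd (N : ℕ) : Set (Matrix (Fin N) (Fin N) ℝ) :=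
  {V | ∃ hV : V.PosDef, LinearIndependent ℚ hV.isHermitian.eigenvalues}

end VelocityFlip

/-!
The theorem is a controllability statement, proved by the classical scheme: rank condition,
recurrence, connectedness and compactness. Only `V ∈ V⁺` is needed.

*Rank condition.* Write `u` for the unit vector of the momentum `p_1`, so that
`I x = x - 2 x(p_1) u`. A word `J(τ_m) ⋯ J(τ_1)` with positive times is chosen so that the space `W`
of velocities at `x = J(τ_m) ⋯ J(τ_1) ψ` obtained by varying the times has maximal dimension. Since
a further flip at time `t` cannot raise the dimension, `W` contains `A x` and all
`e^{-tA} I A I e^{tA} x`, `t > 0`. If a functional `l` kills `W` and `x`, then the functions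
`f(t) = (e^{tA} x)(p_1)` and `g(t) = l(e^{-tA} u)` have Wronskian zero, so `g = c f` on some
interval. The flow preserves the bilinear form `B` of the energy, whence
`f(t) = B(e^{-tA} u, x)`, and `u` is a cyclic vector of `A` because `V ∈ V⁺`; therefore
`l = c B(·, x)`, and `l(x) = 0` gives `l = 0` (`eq_zero_of_apply_conjugates`). So the times and a
dilation factor together move `x` in all directions (`exists_tangentRange_sup_span_eq_top`), and by
the inverse function theorem all states near `ψ` reach all states near `x`, up to dilation
(`exists_eventually_rayReach`).

*Recurrence.* The word is an invertible linear map that preserves the energy, so some of its powers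
bring `ψ` back arbitrarily close to itself. Hence all states near `ψ` reach each other in one and
the same even number of flips (`locReach_self`).

*Globalization.* The punctured phase space is connected, so local reachability in an even number of
flips holds for all pairs of nonzero states (`locReach`). Two flips without waiting cancel, so
numbers of flips of equal parity can be made equal, and compactness of the unit sphere gives a
uniform number of flips (`exists_forall_rayReach`). Between states of equal positive energy the
dilation factor is `1`.
-/

open scoped Matrix

namespace VelocityFlip

open Filter Topology

section Flow

variable {N : ℕ}

/-! ### The Hamiltonian flow -/

/-- The flow map `e^{tA}` as a continuous linear endomorphism of the phase space. -/
noncomputable def flowCLM (V : Matrix (Fin N) (Fin N) ℝ) (t : ℝ) : Phase N →L[ℝ] Phase N :=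
  LinearMap.toContinuousLinearMap (Matrix.toLin' (NormedSpace.exp (t • hamMatrix V)))

/-- The vector field `ψ ↦ Aψ` as a continuous linear endomorphism of the phase space. -/
noncomputable def hamCLM (V : Matrix (Fin N) (Fin N) ℝ) : Phase N →L[ℝ] Phase N :=
  LinearMap.toContinuousLinearMap (Matrix.toLin' (hamMatrix V))

@[simp]
lemma flowCLM_apply (V : Matrix (Fin N) (Fin N) ℝ) (t : ℝ) (x : Phase N) :
    flowCLM V t x = flow V t x := by
  simp [flowCLM, flow]

lemma hamCLM_apply (V : Matrix (Fin N) (Fin N) ℝ) (x : Phase N) :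
    hamCLM V x = hamMatrix V *ᵥ x := by
  simp [hamCLM]

lemma flow_sub (V : Matrix (Fin N) (Fin N) ℝ) (t : ℝ) (x y : Phase N) :
    flow V t (x - y) = flow V t x - flow V t y :=
  Matrix.mulVec_sub _ _ _

lemma flow_smul (V : Matrix (Fin N) (Fin N) ℝ) (t c : ℝ) (x : Phase N) :
    flow V t (c • x) = c • flow V t x :=
  Matrix.mulVec_smul _ _ _

lemma flow_zero (V : Matrix (Fin N) (Fin N) ℝ) (x : Phase N) : flow V 0 x = x := by
  simp [flow, NormedSpace.exp_zero]

lemma flow_add (V : Matrix (Fin N) (Fin N) ℝ) (s t : ℝ) (x : Phase N) :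
    flow V (s + t) x = flow V s (flow V t x) := by
  unfold flow
  rw [Matrix.mulVec_mulVec, add_smul, Matrix.exp_add_of_commute]
  exact ((Commute.refl _).smul_left _).smul_right _

lemma flow_neg_flow (V : Matrix (Fin N) (Fin N) ℝ) (t : ℝ) (x : Phase N) :
    flow V (-t) (flow V t x) = x := by
  rw [← flow_add, neg_add_cancel, flow_zero]

lemma flow_flow_neg (V : Matrix (Fin N) (Fin N) ℝ) (t : ℝ) (x : Phase N) :
    flow V t (flow V (-t) x) = x := by
  rw [← flow_add, add_neg_cancel, flow_zero]

lemma hamCLM_flow (V : Matrix (Fin N) (Fin N) ℝ) (t : ℝ) (x : Phase N) :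
    hamCLM V (flow V t x) = flow V t (hamCLM V x) := by
  have h : Commute (hamMatrix V) (NormedSpace.exp (t • hamMatrix V)) :=
    ((Commute.refl _).smul_right t).exp_right
  rw [hamCLM_apply, hamCLM_apply, flow, flow, Matrix.mulVec_mulVec, Matrix.mulVec_mulVec, h.eq]

section Derivative

attribute [local instance] Matrix.linftyOpNormedRing Matrix.linftyOpNormedAlgebra

lemma hasDerivAt_flowCLM (V : Matrix (Fin N) (Fin N) ℝ) (t : ℝ) :
    HasDerivAt (flowCLM V) (hamCLM V ∘L flowCLM V t) t := by
  have h := hasDerivAt_exp_smul_const' (𝕂 := ℝ) (hamMatrix V) t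
  let L : Matrix (Fin N ⊕ Fin N) (Fin N ⊕ Fin N) ℝ →L[ℝ] (Phase N →L[ℝ] Phase N) :=
    LinearMap.toContinuousLinearMap
      ((LinearMap.toContinuousLinearMap (𝕜 := ℝ) (E := Phase N) (F' := Phase N)).toLinearMap ∘ₗ
        (Matrix.toLin' (R := ℝ) (m := Fin N ⊕ Fin N) (n := Fin N ⊕ Fin N)).toLinearMap)
  have h2 := L.hasFDerivAt.comp_hasDerivAt t h
  have e : L (hamMatrix V * NormedSpace.exp (t • hamMatrix V)) = hamCLM V ∘L flowCLM V t := by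
    ext1 x
    simp [L, hamCLM, flowCLM, Matrix.mulVec_mulVec]
  exact h2.congr_deriv e

end Derivative

lemma contDiff_flowCLM (V : Matrix (Fin N) (Fin N) ℝ) : ContDiff ℝ 1 (flowCLM V) := by
  rw [contDiff_one_iff_deriv]
  refine ⟨fun t => (hasDerivAt_flowCLM V t).differentiableAt, ?_⟩
  have hc : Continuous (flowCLM V) :=
    continuous_iff_continuousAt.2 fun t => (hasDerivAt_flowCLM V t).continuousAt
  have : deriv (flowCLM V) = fun t => hamCLM V ∘L flowCLM V t :=
    funext fun t => (hasDerivAt_flowCLM V t).deriv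
  rw [this]
  exact continuous_const.clm_comp hc

lemma hasDerivAt_flow (V : Matrix (Fin N) (Fin N) ℝ) (x : Phase N) (t : ℝ) :
    HasDerivAt (fun s => flow V s x) (hamCLM V (flow V t x)) t := by
  have h := (hasDerivAt_flowCLM V t).clm_apply (hasDerivAt_const t x)
  rw [map_zero, add_zero] at h
  simpa using h

lemma hasDerivAt_flow_neg (V : Matrix (Fin N) (Fin N) ℝ) (x : Phase N) (t : ℝ) :
    HasDerivAt (fun s => flow V (-s) x) (-hamCLM V (flow V (-t) x)) t := by
  have h := (hasDerivAt_flow V x (-t)).scomp t (hasDerivAt_neg t)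
  rw [neg_one_smul] at h
  exact h

/-! ### The energy form -/

/-- The bilinear form polarizing twice the energy, `(ψ, ψ') ↦ (p, p') + (q, V q')`, with its second
argument fixed, as a linear functional of the first one. -/
noncomputable def energyForm (V : Matrix (Fin N) (Fin N) ℝ) (y : Phase N) : Phase N →L[ℝ] ℝ :=
  LinearMap.toContinuousLinearMap
    ((dotProductBilin ℝ ℝ).flip (Matrix.fromBlocks V 0 0 1 *ᵥ y))

lemma energyForm_apply (V : Matrix (Fin N) (Fin N) ℝ) (x y : Phase N) :
    energyForm V y x = x ⬝ᵥ (Matrix.fromBlocks V 0 0 1 *ᵥ y) := rfl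

lemma energyForm_self (V : Matrix (Fin N) (Fin N) ℝ) (x : Phase N) :
    energyForm V x x = 2 * energy V x := by
  have hx : x = Sum.elim (qPart x) (pPart x) := by
    ext i; cases i <;> rfl
  rw [energyForm_apply, energy]
  conv_lhs => rw [hx]
  rw [Matrix.fromBlocks_mulVec, sumElim_dotProduct_sumElim]
  simp [dotProduct, ← Finset.sum_div]
  ring_nf

lemma energyForm_momentum [NeZero N] (V : Matrix (Fin N) (Fin N) ℝ) (x : Phase N) :
    energyForm V x (Pi.single (Sum.inr 0) 1) = x (Sum.inr 0) := by
  rw [energyForm_apply, single_one_dotProduct, Matrix.fromBlocks_mulVec]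
  simp

section Adjoint

attribute [local instance] Matrix.linftyOpNormedRing Matrix.linftyOpNormedAlgebra

/-- The flow preserves the energy form: `e^{tA}` and `e^{-tA}` are adjoint to each other. -/
lemma energyForm_flow {V : Matrix (Fin N) (Fin N) ℝ} (hV : Vᵀ = V) (t : ℝ) (x y : Phase N) :
    energyForm V (flow V t y) x = energyForm V y (flow V (-t) x) := by
  set M : Matrix (Fin N ⊕ Fin N) (Fin N ⊕ Fin N) ℝ := Matrix.fromBlocks V 0 0 1
  have hMA : SemiconjBy M (t • hamMatrix V) ((-t) • (hamMatrix V)ᵀ) := by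
    unfold SemiconjBy
    simp [M, hamMatrix, Matrix.fromBlocks_transpose, Matrix.fromBlocks_multiply, hV,
      Matrix.fromBlocks_smul, Matrix.fromBlocks_neg]
  have hexp : M * NormedSpace.exp (t • hamMatrix V) =
      (NormedSpace.exp ((-t) • hamMatrix V))ᵀ * M := by
    rw [← Matrix.exp_transpose, Matrix.transpose_smul]
    exact SemiconjBy.exp_right hMA
  rw [energyForm_apply, energyForm_apply, flow, flow, Matrix.mulVec_mulVec, hexp,
    ← Matrix.mulVec_mulVec, Matrix.dotProduct_mulVec, Matrix.vecMul_transpose]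

end Adjoint

lemma energy_flow {V : Matrix (Fin N) (Fin N) ℝ} (hV : Vᵀ = V) (t : ℝ) (x : Phase N) :
    energy V (flow V t x) = energy V x := by
  have h := energyForm_flow hV t (flow V t x) x
  rw [flow_neg_flow, energyForm_self, energyForm_self] at h
  linarith

lemma energy_smul (V : Matrix (Fin N) (Fin N) ℝ) (c : ℝ) (x : Phase N) :
    energy V (c • x) = c ^ 2 * energy V x := by
  have h := energyForm_self V (c • x)
  rw [map_smul, energyForm_apply, Matrix.mulVec_smul, dotProduct_smul, ← energyForm_apply,
    energyForm_self, smul_eq_mul, smul_eq_mul] at h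
  linarith

lemma energy_zero (V : Matrix (Fin N) (Fin N) ℝ) : energy V 0 = 0 := by
  simpa using energy_smul V 0 0

lemma continuous_energy (V : Matrix (Fin N) (Fin N) ℝ) : Continuous (energy V) := by
  unfold energy pPart qPart
  fun_prop

lemma energy_pos {V : Matrix (Fin N) (Fin N) ℝ} (hV : V.PosDef) {x : Phase N} (hx : x ≠ 0) :
    0 < energy V x := by
  have hp : 0 ≤ ∑ k, pPart x k ^ 2 / 2 := Finset.sum_nonneg fun k _ => by positivity
  by_cases hq : qPart x = 0
  · obtain ⟨i, hi⟩ := Function.ne_iff.1 hx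
    have hpos : 0 < ∑ k, pPart x k ^ 2 / 2 := by
      rcases i with i | i
      · exact absurd (congrFun hq i) hi
      · refine Finset.sum_pos' (fun k _ => by positivity) ⟨i, Finset.mem_univ i, ?_⟩
        have : pPart x i ≠ 0 := hi
        positivity
    simpa [energy, hq] using hpos
  · have := hV.dotProduct_mulVec_pos hq
    simp only [star_trivial] at this
    unfold energy
    linarith

/-- The energy of a positive definite matrix dominates the square of the norm. -/
lemma exists_norm_sq_le_energy {V : Matrix (Fin N) (Fin N) ℝ} (hV : V.PosDef) :
    ∃ c > 0, ∀ x : Phase N, c * ‖x‖ ^ 2 ≤ energy V x := by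
  have key : ∃ c > 0, ∀ x ∈ Metric.sphere (0 : Phase N) 1, c ≤ energy V x := by
    rcases (Metric.sphere (0 : Phase N) 1).eq_empty_or_nonempty with h | h
    · exact ⟨1, one_pos, by simp [h]⟩
    · obtain ⟨x, hx, hmin⟩ := (isCompact_sphere (0 : Phase N) 1).exists_isMinOn h
        (continuous_energy V).continuousOn
      exact ⟨_, energy_pos hV (ne_zero_of_mem_unit_sphere ⟨x, hx⟩), fun y hy => hmin hy⟩
  obtain ⟨c, hc, h⟩ := key
  refine ⟨c, hc, fun x => ?_⟩
  by_cases hx : x = 0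
  · simp [hx, energy_zero]
  have hn : ‖x‖ ≠ 0 := norm_ne_zero_iff.2 hx
  have h1 := h (‖x‖⁻¹ • x) (by simp [norm_smul, hn])
  rw [energy_smul, inv_pow, inv_mul_eq_div, le_div_iff₀ (by positivity)] at h1
  exact h1

end Flow

variable {N : ℕ} [NeZero N]

/-! ### Cyclicity of the flipped momentum -/

/-- The unit vector of the phase space in the direction of the flipped momentum `p_1`. -/
def flipVec (N : ℕ) [NeZero N] : Phase N := Pi.single (Sum.inr 0) 1

lemma flip_eq (x : Phase N) : flip x = x - (2 * x (Sum.inr 0)) • flipVec N := by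
  ext i
  by_cases h : i = Sum.inr 0
  · subst h
    simp [flip, flipVec]
    ring
  · simp [flip, flipVec, h]

lemma hamCLM_elim {N : ℕ} (V : Matrix (Fin N) (Fin N) ℝ) (q p : Fin N → ℝ) :
    hamCLM V (Sum.elim q p) = Sum.elim p (-V *ᵥ q) := by
  rw [hamCLM_apply, hamMatrix, Matrix.fromBlocks_mulVec]
  simp

lemma hamCLM_pow_flipVec (V : Matrix (Fin N) (Fin N) ℝ) (k : ℕ) :
    (hamCLM V ^ (2 * k)) (flipVec N) = Sum.elim (0 : Fin N → ℝ) ((-V) ^ k *ᵥ Pi.single 0 1) := by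
  induction k with
  | zero =>
    ext i
    rcases i with i | i <;> simp [flipVec, Pi.single_apply, Matrix.one_apply]
  | succ k ih =>
    rw [show 2 * (k + 1) = 1 + (1 + 2 * k) by ring, pow_add, pow_add, pow_one,
      mul_apply_eq_comp, mul_apply_eq_comp, ih, hamCLM_elim, hamCLM_elim,
      Matrix.mulVec_mulVec, ← pow_succ']
    simp

/-- The momentum direction of the flipped particle is a cyclic vector of `A`. -/
lemma eq_zero_of_apply_hamCLM_pow {V : Matrix (Fin N) (Fin N) ℝ} (hV : mixingSubspace V = ⊤)
    (l : Phase N →L[ℝ] ℝ) (h : ∀ k, l ((hamCLM V ^ k) (flipVec N)) = 0) : l = 0 := by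
  have hcyc : cyclicSubspace V = ⊤ := by
    refine Submodule.eq_top_iff'.2 fun x => ?_
    have : (Sum.elim x 0 : Phase N) ∈ mixingSubspace V := hV ▸ Submodule.mem_top
    exact this.1
  have key : ∀ f : (Fin N → ℝ) →ₗ[ℝ] ℝ, (∀ k, f ((-V) ^ k *ᵥ Pi.single 0 1) = 0) → f = 0 := by
    intro f hf
    rw [← LinearMap.ker_eq_top, eq_top_iff, ← hcyc, cyclicSubspace, Submodule.span_le]
    rintro _ ⟨k, rfl⟩
    have hk := hf k
    rcases k.even_or_odd with h | h
    · rwa [h.neg_pow] at hk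
    · rwa [h.neg_pow, Matrix.neg_mulVec, map_neg, neg_eq_zero] at hk
  let e := (LinearEquiv.sumArrowLequivProdArrow (Fin N) (Fin N) ℝ ℝ).symm
  have hq := key (l.toLinearMap ∘ₗ e.toLinearMap ∘ₗ LinearMap.inl ℝ _ _) fun k => by
    have := h (1 + 2 * k)
    rwa [pow_add, pow_one, mul_apply_eq_comp, hamCLM_pow_flipVec, hamCLM_elim,
      Matrix.mulVec_zero] at this
  have hp := key (l.toLinearMap ∘ₗ e.toLinearMap ∘ₗ LinearMap.inr ℝ _ _) fun k => by
    have := h (2 * k)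
    rwa [hamCLM_pow_flipVec] at this
  have hle : l.toLinearMap ∘ₗ e.toLinearMap = 0 :=
    LinearMap.prod_ext (by rw [LinearMap.comp_assoc, hq, LinearMap.zero_comp])
      (by rw [LinearMap.comp_assoc, hp, LinearMap.zero_comp])
  ext1 x
  simpa using LinearMap.congr_fun hle (e.symm x)

/-- A functional that vanishes along a piece of the orbit of `flipVec` under the flow vanishes:
its successive derivatives along the orbit are its values on the iterates of `A`. -/
lemma eq_zero_of_eventually_apply_flow {V : Matrix (Fin N) (Fin N) ℝ} (hV : mixingSubspace V = ⊤)
    (l : Phase N →L[ℝ] ℝ) (t₀ : ℝ) (h : ∀ᶠ t in 𝓝 t₀, l (flow V (-t) (flipVec N)) = 0) :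
    l = 0 := by
  have hk : ∀ k, ∀ᶠ t in 𝓝 t₀, l ((hamCLM V ^ k) (flow V (-t) (flipVec N))) = 0 := by
    intro k
    induction k with
    | zero => simpa using h
    | succ k ih =>
      filter_upwards [eventually_eventually_nhds.2 ih] with t ht
      have hd := ((l ∘L (hamCLM V ^ k)).hasFDerivAt.comp_hasDerivAt t
        (hasDerivAt_flow_neg V (flipVec N) t))
      have h0 := hd.unique ((hasDerivAt_const t (0 : ℝ)).congr_of_eventuallyEq ht)
      rw [map_neg, neg_eq_zero] at h0
      rw [pow_succ]
      exact h0
  have hcomm : ∀ k x, (hamCLM V ^ k) (flow V (-t₀) x) = flow V (-t₀) ((hamCLM V ^ k) x) := by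
    intro k
    induction k with
    | zero => simp
    | succ k ih =>
      intro x
      rw [pow_succ, mul_apply_eq_comp, mul_apply_eq_comp, hamCLM_flow, ih]
  have hl : l ∘L flowCLM V (-t₀) = 0 := eq_zero_of_apply_hamCLM_pow hV _ fun k => by
    rw [ContinuousLinearMap.comp_apply, flowCLM_apply, ← hcomm]
    exact (hk k).self_of_nhds
  ext x
  have := DFunLike.congr_fun hl (flow V t₀ x)
  simpa [flow_neg_flow] using this

lemma energyForm_flow_flipVec {V : Matrix (Fin N) (Fin N) ℝ} (hV : Vᵀ = V) (t : ℝ) (x : Phase N) :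
    energyForm V x (flow V (-t) (flipVec N)) = flow V t x (Sum.inr 0) := by
  rw [← energyForm_flow hV, flipVec, energyForm_momentum]

/-- The vector fields `A` and `e^{-tA} I A I e^{tA}`, `t > 0`, together with the Euler field, span
the phase space at every point `x ≠ 0`: no nonzero functional kills them all. -/
lemma eq_zero_of_apply_conjugates {V : Matrix (Fin N) (Fin N) ℝ} (hV : V ∈ VPlus N)
    {x : Phase N} (hx : x ≠ 0) (l : Phase N →L[ℝ] ℝ) (h0 : l x = 0) (h1 : l (hamCLM V x) = 0)
    (h2 : ∀ t > 0, l (flow V (-t) (flip (hamCLM V (flip (flow V t x))))) = 0) : l = 0 := by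
  obtain ⟨hpos, hmix⟩ := hV
  have hsymm : Vᵀ = V := by simpa using hpos.isHermitian.eq
  set f : ℝ → ℝ := fun t => flow V t x (Sum.inr 0) with hf
  set g : ℝ → ℝ := fun t => l (flow V (-t) (flipVec N)) with hg
  have hf' : ∀ t, HasDerivAt f (hamCLM V (flow V t x) (Sum.inr 0)) t := fun t =>
    hasDerivAt_pi.1 (hasDerivAt_flow V x t) (Sum.inr 0)
  have hg' : ∀ t, HasDerivAt g (-l (hamCLM V (flow V (-t) (flipVec N)))) t := fun t => by
    have := l.hasFDerivAt.comp_hasDerivAt t (hasDerivAt_flow_neg V (flipVec N) t)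
    rwa [map_neg] at this
  -- The hypothesis on the conjugates of `A` says that the Wronskian of `f` and `g` vanishes.
  have hw : ∀ t > 0, -l (hamCLM V (flow V (-t) (flipVec N))) * f t -
      g t * hamCLM V (flow V t x) (Sum.inr 0) = 0 := by
    intro t ht
    have hAu : hamCLM V (flipVec N) (Sum.inr 0) = 0 := by
      simp [hamCLM_apply, flipVec, hamMatrix]
    have := h2 t ht
    rw [flip_eq (hamCLM V (flip (flow V t x))), flip_eq (flow V t x), map_sub, map_smul,
      Pi.sub_apply, Pi.smul_apply, hAu] at this
    simp only [flow_sub, flow_smul, map_sub, map_smul, ← hamCLM_flow, flow_neg_flow, h1,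
      smul_eq_mul, mul_zero, sub_zero] at this
    simp only [hf, hg]
    linarith
  obtain ⟨t₀, ht₀, hft₀⟩ : ∃ t > 0, f t ≠ 0 := by
    by_contra! hcon
    refine hx ?_
    have hz : energyForm V x = 0 := by
      refine eq_zero_of_eventually_apply_flow hmix _ 1 ?_
      filter_upwards [lt_mem_nhds one_pos] with t ht
      rw [energyForm_flow_flipVec hsymm]
      exact hcon t ht
    by_contra hx0
    have := energyForm_self V x
    rw [hz] at this
    exact (energy_pos hpos hx0).ne' (by simpa using this)
  have hfc : Continuous f := continuous_iff_continuousAt.2 fun t => (hf' t).continuousAt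
  obtain ⟨ε, hε, hball⟩ := Metric.eventually_nhds_iff_ball.1
    ((lt_mem_nhds ht₀).and (hfc.continuousAt.eventually_ne hft₀))
  -- Hence `g / f` is constant near a point where `f` does not vanish.
  have hconst : ∀ t ∈ Metric.ball t₀ ε, g t / f t = g t₀ / f t₀ := by
    intro t ht
    have hd : ∀ s ∈ Metric.ball t₀ ε, HasDerivAt (fun s => g s / f s) 0 s := fun s hs =>
      ((hg' s).div (hf' s) (hball s hs).2).congr_deriv (by rw [hw s (hball s hs).1, zero_div])
    exact Metric.isOpen_ball.is_const_of_deriv_eq_zero (convex_ball t₀ ε).isPreconnected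
      (fun s hs => (hd s hs).differentiableAt.differentiableWithinAt)
      (fun s hs => (hd s hs).deriv) ht (Metric.mem_ball_self hε)
  set c := g t₀ / f t₀
  have hl : l - c • energyForm V x = 0 := by
    refine eq_zero_of_eventually_apply_flow hmix _ t₀ ?_
    filter_upwards [Metric.ball_mem_nhds t₀ hε] with t ht
    have := (div_eq_iff (hball t ht).2).1 (hconst t ht)
    rw [sub_apply, smul_apply,
      energyForm_flow_flipVec hsymm, smul_eq_mul]
    exact sub_eq_zero.2 this
  rw [sub_eq_zero] at hl
  have hc : c = 0 := by
    rw [hl, smul_apply, energyForm_self, smul_eq_mul] at h0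
    simpa [(energy_pos hpos hx).ne'] using h0
  rw [hl, hc, zero_smul]

/-! ### Words in the maps `J(t)` -/

/-- The velocity flip as a continuous linear endomorphism of the phase space. -/
noncomputable def flipCLM (N : ℕ) [NeZero N] : Phase N →L[ℝ] Phase N :=
  ContinuousLinearMap.id ℝ _ -
    ((2 : ℝ) • ContinuousLinearMap.proj (R := ℝ) (φ := fun _ => ℝ) (Sum.inr 0)).smulRight
      (flipVec N)

@[simp]
lemma flipCLM_apply (x : Phase N) : flipCLM N x = flip x := by
  simp [flipCLM, flip_eq]

@[simp]
lemma flip_flip (x : Phase N) : flip (flip x) = x := by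
  simp [flip]

lemma energy_flip (V : Matrix (Fin N) (Fin N) ℝ) (x : Phase N) :
    energy V (flip x) = energy V x := by
  have hq : qPart (flip x) = qPart x := by
    ext k
    simp [qPart, flip]
  have hp : ∀ k, pPart (flip x) k ^ 2 = pPart x k ^ 2 := by
    intro k
    by_cases h : k = 0
    · subst h
      simp [pPart, flip]
    · simp [pPart, flip, h]
  simp only [energy, hq, hp]

/-- The map `J(t)` as a continuous linear automorphism of the phase space. -/
noncomputable def flowFlipEquiv (V : Matrix (Fin N) (Fin N) ℝ) (t : ℝ) :
    Phase N ≃L[ℝ] Phase N :=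
  ContinuousLinearEquiv.equivOfInverse (flipCLM N ∘L flowCLM V t) (flowCLM V (-t) ∘L flipCLM N)
    (fun x => by simp [flow_neg_flow]) (fun x => by simp [flow_flow_neg])

@[simp]
lemma flowFlipEquiv_apply (V : Matrix (Fin N) (Fin N) ℝ) (t : ℝ) (x : Phase N) :
    flowFlipEquiv V t x = flowFlip V t x := by
  simp [flowFlipEquiv, flowFlip]

lemma flowFlipEquiv_symm_apply (V : Matrix (Fin N) (Fin N) ℝ) (t : ℝ) (x : Phase N) :
    (flowFlipEquiv V t).symm x = flow V (-t) (flip x) := by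
  simp [flowFlipEquiv]

@[simp]
lemma stateAtFlip_zero (V : Matrix (Fin N) (Fin N) ℝ) (τ : Fin 0 → ℝ) (x : Phase N) :
    stateAtFlip V τ x = x := by
  simp [stateAtFlip]

lemma stateAtFlip_succ (V : Matrix (Fin N) (Fin N) ℝ) {m : ℕ} (τ : Fin (m + 1) → ℝ) (x : Phase N) :
    stateAtFlip V τ x = flowFlip V (τ (Fin.last m)) (stateAtFlip V (fun i => τ i.castSucc) x) := by
  simp [stateAtFlip, Fin.foldl_succ_last]

lemma stateAtFlip_snoc (V : Matrix (Fin N) (Fin N) ℝ) {m : ℕ} (τ : Fin m → ℝ) (t : ℝ)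
    (x : Phase N) :
    stateAtFlip V (Fin.snoc τ t : Fin (m + 1) → ℝ) x = flowFlip V t (stateAtFlip V τ x) := by
  simp [stateAtFlip_succ]

lemma stateAtFlip_append (V : Matrix (Fin N) (Fin N) ℝ) {m k : ℕ} (τ : Fin m → ℝ) (σ : Fin k → ℝ)
    (x : Phase N) :
    stateAtFlip V (Fin.append τ σ) x = stateAtFlip V σ (stateAtFlip V τ x) := by
  induction k with
  | zero => simp [Fin.append_right_nil]
  | succ k ih =>
    rw [stateAtFlip_succ V σ, ← ih]
    refine (stateAtFlip_succ V (m := m + k) _ x).trans ?_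
    congr 2
    · exact Fin.append_right τ σ (Fin.last k)
    · ext i
      refine Fin.addCases (fun j => ?_) (fun j => ?_) i
      · rw [Fin.append_left]
        exact Fin.append_left τ σ j
      · rw [Fin.append_right]
        exact Fin.append_right τ σ j.castSucc

lemma energy_stateAtFlip {V : Matrix (Fin N) (Fin N) ℝ} (hV : Vᵀ = V) {m : ℕ} (τ : Fin m → ℝ)
    (x : Phase N) : energy V (stateAtFlip V τ x) = energy V x := by
  induction m with
  | zero => simp
  | succ m ih => rw [stateAtFlip_succ, flowFlip, energy_flip, energy_flow hV, ih]

lemma exists_equiv_stateAtFlip (V : Matrix (Fin N) (Fin N) ℝ) {m : ℕ} (τ : Fin m → ℝ) :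
    ∃ e : Phase N ≃L[ℝ] Phase N, ∀ x, e x = stateAtFlip V τ x := by
  induction m with
  | zero => exact ⟨ContinuousLinearEquiv.refl ℝ _, fun x => by simp⟩
  | succ m ih =>
    obtain ⟨e, he⟩ := ih fun i => τ i.castSucc
    exact ⟨e.trans (flowFlipEquiv V (τ (Fin.last m))), fun x => by simp [he, stateAtFlip_succ]⟩

lemma contDiff_stateAtFlip (V : Matrix (Fin N) (Fin N) ℝ) (m : ℕ) :
    ContDiff ℝ 1 fun z : Phase N × (Fin m → ℝ) => stateAtFlip V z.2 z.1 := by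
  induction m with
  | zero => simpa using contDiff_fst
  | succ m ih =>
    have h1 : ContDiff ℝ 1 fun z : Phase N × (Fin (m + 1) → ℝ) =>
        stateAtFlip V (fun i : Fin m => z.2 i.castSucc) z.1 := by
      refine ih.comp (g := fun z : Phase N × (Fin m → ℝ) => stateAtFlip V z.2 z.1)
        (f := fun z : Phase N × (Fin (m + 1) → ℝ) => (z.1, fun i : Fin m => z.2 i.castSucc)) ?_
      fun_prop
    have h2 : ContDiff ℝ 1 fun z : Phase N × (Fin (m + 1) → ℝ) =>
        flowCLM V (z.2 (Fin.last m)) :=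
      (contDiff_flowCLM V).comp (by fun_prop)
    have h3 := (flipCLM N).contDiff.comp (h2.clm_apply h1)
    convert h3 using 1
    ext1 z
    simp [stateAtFlip_succ, flowFlip]

/-! ### Directions obtained by varying the waiting times -/

/-- The space of velocities at `J(τ_m) ⋯ J(τ_1) x` obtained by varying the waiting times `τ`. -/
noncomputable def tangentRange (V : Matrix (Fin N) (Fin N) ℝ) {m : ℕ} (τ : Fin m → ℝ)
    (x : Phase N) : Submodule ℝ (Phase N) :=
  (fderiv ℝ (fun σ => stateAtFlip V σ x) τ).range

lemma differentiable_stateAtFlip (V : Matrix (Fin N) (Fin N) ℝ) (m : ℕ) (x : Phase N) :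
    Differentiable ℝ fun τ : Fin m → ℝ => stateAtFlip V τ x := by
  have h : ContDiff ℝ 1 fun τ : Fin m → ℝ => stateAtFlip V τ x :=
    (contDiff_stateAtFlip V m).comp (f := fun τ => (x, τ)) (by fun_prop)
  exact h.differentiable one_ne_zero

/-- One more flip transports the directions already available, together with the direction of the
Hamiltonian vector field at the present state. -/
lemma map_tangentRange_le (V : Matrix (Fin N) (Fin N) ℝ) {m : ℕ} (τ : Fin m → ℝ) (t : ℝ)
    (x : Phase N) :
    (tangentRange V τ x ⊔ Submodule.span ℝ {hamCLM V (stateAtFlip V τ x)}).map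
        (flowFlipEquiv V t).toLinearEquiv.toLinearMap ≤
      tangentRange V (Fin.snoc τ t : Fin (m + 1) → ℝ) x := by
  set σ : Fin (m + 1) → ℝ := Fin.snoc τ t with hσ
  let P : (Fin (m + 1) → ℝ) →L[ℝ] (Fin m → ℝ) :=
    ContinuousLinearMap.pi fun i => ContinuousLinearMap.proj i.castSucc
  have hPσ : P σ = τ := by
    ext i
    simp [P, hσ]
  have h1 : HasFDerivAt (fun ρ => stateAtFlip V (P ρ) x)
      (fderiv ℝ (fun ρ => stateAtFlip V ρ x) τ ∘L P) σ := by
    have := (differentiable_stateAtFlip V m x τ).hasFDerivAt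
    rw [← hPσ] at this ⊢
    exact this.comp σ P.hasFDerivAt
  have h2 := ((hasDerivAt_flowCLM V (σ (Fin.last m))).hasFDerivAt.comp σ
    (ContinuousLinearMap.proj (R := ℝ) (φ := fun _ => ℝ) (Fin.last m)).hasFDerivAt)
  have h3 := (flipCLM N).hasFDerivAt.comp σ (h2.clm_apply h1)
  have hfun : (fun ρ : Fin (m + 1) → ℝ => stateAtFlip V ρ x) =
      (flipCLM N) ∘ fun ρ => (flowCLM V ∘ (ContinuousLinearMap.proj (R := ℝ) (φ := fun _ => ℝ)
        (Fin.last m))) ρ (stateAtFlip V (P ρ) x) := by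
    ext1 ρ
    simp [stateAtFlip_succ, flowFlip, P]
  have hD : ∀ v, fderiv ℝ (fun ρ => stateAtFlip V ρ x) σ v = flowFlip V t
      (fderiv ℝ (fun ρ => stateAtFlip V ρ x) τ (P v) +
        v (Fin.last m) • hamCLM V (stateAtFlip V τ x)) := by
    intro v
    rw [hfun, h3.fderiv]
    simp [flowFlip, hσ, hamCLM_flow]
    rw [← hσ, hPσ]
    change flowFlip V t _ + _ • flowFlip V t _ = flowFlip V t _
    simp only [← flowFlipEquiv_apply, map_add, map_smul]
  rw [Submodule.map_sup, sup_le_iff, Submodule.map_span_le, Submodule.map_le_iff_le_comap]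
  constructor
  · rintro _ ⟨v, rfl⟩
    refine ⟨(Fin.snoc v 0 : Fin (m + 1) → ℝ), ?_⟩
    have : P (Fin.snoc v 0 : Fin (m + 1) → ℝ) = v := by
      ext i
      simp [P]
    refine (hD _).trans ?_
    rw [this]
    simp
  · rintro _ rfl
    refine ⟨(Fin.snoc 0 1 : Fin (m + 1) → ℝ), ?_⟩
    have : P (Fin.snoc 0 1 : Fin (m + 1) → ℝ) = 0 := by
      ext i
      simp [P]
    refine (hD _).trans ?_
    rw [this]
    simp

/-- From every nonzero state some word with positive waiting times has the property that the
variations of the waiting times together with the dilations give all directions. The word is chosen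
so that the rank is maximal: one more flip cannot raise it, which forces `A` and all its
conjugates `e^{-tA} I A I e^{tA}` to be tangent to the space of directions. -/
lemma exists_tangentRange_sup_span_eq_top {V : Matrix (Fin N) (Fin N) ℝ} (hV : V ∈ VPlus N)
    {x : Phase N} (hx : x ≠ 0) :
    ∃ (m : ℕ) (τ : Fin m → ℝ), (∀ i, 0 < τ i) ∧
      tangentRange V τ x ⊔ Submodule.span ℝ {stateAtFlip V τ x} = ⊤ := by
  set S : Set ℕ := {d | ∃ (m : ℕ) (τ : Fin m → ℝ), (∀ i, 0 < τ i) ∧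
    Module.finrank ℝ (tangentRange V τ x) = d} with hS
  have hne : S.Nonempty := ⟨_, 0, fun _ => 1, fun _ => one_pos, rfl⟩
  have hbdd : BddAbove S := ⟨Module.finrank ℝ (Phase N), by
    rintro _ ⟨m, τ, -, rfl⟩
    exact Submodule.finrank_le _⟩
  obtain ⟨m, τ, hτ, hmax⟩ := Nat.sSup_mem hne hbdd
  have hle : ∀ {k : ℕ} (σ : Fin k → ℝ), (∀ i, 0 < σ i) →
      Module.finrank ℝ (tangentRange V σ x) ≤ Module.finrank ℝ (tangentRange V τ x) :=
    fun σ hσ => hmax ▸ le_csSup hbdd ⟨_, σ, hσ, rfl⟩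
  have hsnoc : ∀ {k : ℕ} {σ : Fin k → ℝ} {t : ℝ}, (∀ i, 0 < σ i) → 0 < t →
      ∀ i, 0 < (Fin.snoc σ t : Fin (k + 1) → ℝ) i := by
    intro k σ t hσ ht i
    refine Fin.lastCases ?_ (fun j => ?_) i
    · simpa using ht
    · simpa using hσ j
  -- A word of maximal rank already has the direction of `A`, as one more flip keeps it available.
  have hmem : ∀ {k : ℕ} (σ : Fin k → ℝ), (∀ i, 0 < σ i) →
      Module.finrank ℝ (tangentRange V σ x) = Module.finrank ℝ (tangentRange V τ x) →
      hamCLM V (stateAtFlip V σ x) ∈ tangentRange V σ x := by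
    intro k σ hσ hrank
    have h1 := Submodule.finrank_mono (map_tangentRange_le V σ 1 x)
    rw [LinearEquiv.finrank_map_eq] at h1
    have h2 := Submodule.eq_of_le_of_finrank_le
      (le_sup_left : tangentRange V σ x ≤ _ ⊔ Submodule.span ℝ {hamCLM V (stateAtFlip V σ x)})
      (h1.trans ((hle _ (hsnoc hσ one_pos)).trans hrank.ge))
    rw [h2]
    exact Submodule.mem_sup_right (Submodule.mem_span_singleton_self _)
  have hconj : ∀ t > 0, flow V (-t) (flip (hamCLM V (flip (flow V t (stateAtFlip V τ x))))) ∈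
      tangentRange V τ x := by
    intro t ht
    have h1 := (Submodule.map_mono (le_sup_left : tangentRange V τ x ≤ _)).trans
      (map_tangentRange_le V τ t x)
    have h2 := Submodule.eq_of_le_of_finrank_le h1
      (by rw [LinearEquiv.finrank_map_eq]; exact hle _ (hsnoc hτ ht))
    have h3 := hmem (Fin.snoc τ t : Fin (m + 1) → ℝ) (hsnoc hτ ht)
      (by rw [← h2, LinearEquiv.finrank_map_eq])
    rw [← h2, stateAtFlip_snoc] at h3
    obtain ⟨w, hw, hw'⟩ := h3
    have : w = (flowFlipEquiv V t).symm (hamCLM V (flowFlip V t (stateAtFlip V τ x))) :=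
      (flowFlipEquiv V t).injective (by simpa using hw')
    rw [flowFlipEquiv_symm_apply] at this
    exact this ▸ hw
  refine ⟨m, τ, hτ, ?_⟩
  by_contra hcon
  obtain ⟨l, hl, hker⟩ := Submodule.exists_le_ker_of_lt_top _ (lt_top_iff_ne_top.2 hcon)
  have hkill : ∀ w ∈ tangentRange V τ x, l w = 0 := fun w hw =>
    hker (Submodule.mem_sup_left hw)
  have hx' : stateAtFlip V τ x ≠ 0 := by
    obtain ⟨e, he⟩ := exists_equiv_stateAtFlip V τ
    rw [← he]
    simpa using hx
  have := eq_zero_of_apply_conjugates hV hx' (LinearMap.toContinuousLinearMap l)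
    (hker (Submodule.mem_sup_right (Submodule.mem_span_singleton_self _)))
    (hkill _ (hmem τ hτ rfl)) (fun t ht => hkill _ (hconj t ht))
  exact hl (by simpa using this)

/-! ### Reachability up to dilation -/

/-- The state `y` is a positive multiple of a state reachable from `x` at the `m`-th flip. For `x`
and `y` on the same energy surface the factor is `1`; dilations are admitted so that neighborhoods
in the phase space can be used in place of neighborhoods in an energy surface. -/
def RayReach (V : Matrix (Fin N) (Fin N) ℝ) (m : ℕ) (x y : Phase N) : Prop :=
  ∃ r : ℝ, 0 < r ∧ ∃ τ : Fin m → ℝ, (∀ i, 0 ≤ τ i) ∧ y = r • stateAtFlip V τ x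

lemma stateAtFlip_smul (V : Matrix (Fin N) (Fin N) ℝ) {m : ℕ} (τ : Fin m → ℝ) (c : ℝ)
    (x : Phase N) : stateAtFlip V τ (c • x) = c • stateAtFlip V τ x := by
  obtain ⟨e, he⟩ := exists_equiv_stateAtFlip V τ
  rw [← he, ← he, map_smul]

lemma rayReach_stateAtFlip (V : Matrix (Fin N) (Fin N) ℝ) {m : ℕ} {τ : Fin m → ℝ}
    (hτ : ∀ i, 0 ≤ τ i) (x : Phase N) : RayReach V m x (stateAtFlip V τ x) :=
  ⟨1, one_pos, τ, hτ, (one_smul _ _).symm⟩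

lemma RayReach.trans {V : Matrix (Fin N) (Fin N) ℝ} {m k : ℕ} {x y z : Phase N}
    (hxy : RayReach V m x y) (hyz : RayReach V k y z) : RayReach V (m + k) x z := by
  obtain ⟨r, hr, τ, hτ, rfl⟩ := hxy
  obtain ⟨s, hs, σ, hσ, rfl⟩ := hyz
  refine ⟨s * r, mul_pos hs hr, Fin.append τ σ, fun i => ?_, ?_⟩
  · refine Fin.addCases (fun j => ?_) (fun j => ?_) i
    · simpa using hτ j
    · simpa using hσ j
  · rw [stateAtFlip_append, stateAtFlip_smul, mul_smul]

/-- Two flips without waiting cancel. -/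
lemma rayReach_self_of_even (V : Matrix (Fin N) (Fin N) ℝ) {m : ℕ} (hm : Even m) (x : Phase N) :
    RayReach V m x x := by
  obtain ⟨k, rfl⟩ := hm
  induction k with
  | zero => simpa using rayReach_stateAtFlip V (τ := fun i : Fin 0 => 0) (fun _ => le_rfl) x
  | succ k ih =>
    have h2 : RayReach V 2 x x := by
      simpa [stateAtFlip_succ, flowFlip, flow_zero] using
        rayReach_stateAtFlip V (τ := fun i : Fin 2 => 0) (fun _ => le_rfl) x
    have := ih.trans h2
    rwa [show k + 1 + (k + 1) = k + k + 2 by ring]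

lemma RayReach.mono {V : Matrix (Fin N) (Fin N) ℝ} {m k : ℕ} {x y : Phase N}
    (h : RayReach V m x y) (hk : Even k) : RayReach V (m + k) x y :=
  h.trans (rayReach_self_of_even V hk y)

/-- All states near `x` reach all states near a suitable state reachable from `x`. -/
lemma exists_eventually_rayReach {V : Matrix (Fin N) (Fin N) ℝ} (hV : V ∈ VPlus N)
    {x : Phase N} (hx : x ≠ 0) :
    ∃ (m : ℕ) (τ : Fin m → ℝ), (∀ i, 0 ≤ τ i) ∧
      ∀ᶠ z in 𝓝 (x, stateAtFlip V τ x), RayReach V m z.1 z.2 := by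
  obtain ⟨m, τ, hτ, htop⟩ := exists_tangentRange_sup_span_eq_top hV hx
  refine ⟨m, τ, fun i => (hτ i).le, ?_⟩
  let E := Phase N × ℝ × (Fin m → ℝ)
  let Ψ : E → Phase N := fun w => w.2.1 • stateAtFlip V w.2.2 w.1
  let Φ : E → Phase N × Phase N := fun w => (w.1, Ψ w)
  let a : E := (x, 1, τ)
  have hΨ : ContDiff ℝ 1 Ψ := by
    have h1 : ContDiff ℝ 1 fun w : E => stateAtFlip V w.2.2 w.1 :=
      (contDiff_stateAtFlip V m).comp (f := fun w : E => (w.1, w.2.2)) (by fun_prop)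
    exact (contDiff_fst.comp contDiff_snd).smul h1
  have hstrict : HasStrictFDerivAt Ψ (fderiv ℝ Ψ a) a :=
    hΨ.contDiffAt.hasStrictFDerivAt one_ne_zero
  have hΦ : HasStrictFDerivAt Φ ((ContinuousLinearMap.fst ℝ _ _).prod (fderiv ℝ Ψ a)) a :=
    hasStrictFDerivAt_fst.prodMk hstrict
  -- The derivatives of `Ψ` in the waiting times and in the dilation factor.
  have hτdir : ∀ v, fderiv ℝ Ψ a (0, 0, v) = fderiv ℝ (fun σ => stateAtFlip V σ x) τ v := by
    intro v
    have h : HasFDerivAt (fun σ : Fin m → ℝ => ((x, 1, σ) : E))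
        ((0 : (Fin m → ℝ) →L[ℝ] Phase N).prod ((0 : (Fin m → ℝ) →L[ℝ] ℝ).prod
          (ContinuousLinearMap.id ℝ _))) τ :=
      (hasFDerivAt_const x τ).prodMk ((hasFDerivAt_const (1 : ℝ) τ).prodMk (hasFDerivAt_id τ))
    have h2 := (HasFDerivAt.comp τ (f := fun σ : Fin m → ℝ => ((x, 1, σ) : E))
      hstrict.hasFDerivAt h).fderiv
    have h3 : Ψ ∘ (fun σ : Fin m → ℝ => ((x, 1, σ) : E)) = fun σ => stateAtFlip V σ x := by
      ext1 σ
      simp [Ψ]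
    rw [h3] at h2
    rw [h2]
    simp
  have hrdir : fderiv ℝ Ψ a (0, 1, 0) = stateAtFlip V τ x := by
    have h : HasDerivAt (fun r : ℝ => ((x, r, τ) : E)) (0, 1, 0) 1 :=
      (hasDerivAt_const 1 x).prodMk ((hasDerivAt_id 1).prodMk (hasDerivAt_const 1 τ))
    have h2 := HasFDerivAt.comp_hasDerivAt (1 : ℝ) (f := fun r : ℝ => ((x, r, τ) : E))
      hstrict.hasFDerivAt h
    refine h2.unique ?_
    simpa [Ψ, Function.comp_def] using (hasDerivAt_id (1 : ℝ)).smul_const (stateAtFlip V τ x)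
  have hsurj : ∀ y, ∃ c, fderiv ℝ Ψ a (0, c) = y := by
    intro y
    have hy : y ∈ tangentRange V τ x ⊔ Submodule.span ℝ {stateAtFlip V τ x} :=
      htop ▸ Submodule.mem_top
    obtain ⟨_, ⟨v, rfl⟩, _, hz, rfl⟩ := Submodule.mem_sup.1 hy
    obtain ⟨s, rfl⟩ := Submodule.mem_span_singleton.1 hz
    refine ⟨(s, v), ?_⟩
    have : ((0, s, v) : E) = (0, 0, v) + s • (0, 1, 0) := by simp
    rw [this, map_add, map_smul, hτdir, hrdir]
    rfl
  have hrange : ((ContinuousLinearMap.fst ℝ _ _).prod (fderiv ℝ Ψ a)).range = ⊤ := by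
    refine LinearMap.range_eq_top.2 fun ⟨b, y⟩ => ?_
    obtain ⟨c, hc⟩ := hsurj (y - fderiv ℝ Ψ a (b, 0))
    refine ⟨(b, c), ?_⟩
    have : ((b, c) : E) = (b, 0) + (0, c) := by simp
    refine Prod.ext rfl ?_
    change fderiv ℝ Ψ a (b, c) = y
    rw [this, map_add, hc, add_sub_cancel]
  have hmap := hΦ.map_nhds_eq_of_surj hrange
  have ha : Φ a = (x, stateAtFlip V τ x) := by simp [Φ, Ψ, a]
  rw [← ha, ← hmap, eventually_map]
  have hpos : ∀ᶠ w : E in 𝓝 a, 0 < w.2.1 ∧ ∀ i, 0 ≤ w.2.2 i := by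
    refine Filter.Eventually.and ?_ (eventually_all.2 fun i => ?_)
    · exact (continuous_fst.comp continuous_snd).continuousAt.eventually (lt_mem_nhds one_pos)
    · have hc : Continuous fun w : E => w.2.2 i := by fun_prop
      exact (hc.continuousAt.eventually (lt_mem_nhds (hτ i))).mono fun _ h => h.le
  filter_upwards [hpos] with w hw
  exact ⟨w.2.1, hw.1, w.2.2, hw.2, rfl⟩

/-- Poincaré recurrence for a linear map preserving the energy, at every point of the phase space:
the orbit stays in a compact energy surface and the energy of a difference is a distance that the
map preserves. -/
lemma exists_iterate_mem_nhds {N : ℕ} {V : Matrix (Fin N) (Fin N) ℝ} (hV : V.PosDef)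
    (f : Phase N →L[ℝ] Phase N) (hf : ∀ x, energy V (f x) = energy V x) (x : Phase N)
    {U : Set (Phase N)} (hU : U ∈ 𝓝 x) : ∃ n, f^[n + 1] x ∈ U := by
  obtain ⟨c, hc, hnorm⟩ := exists_norm_sq_le_energy hV
  have hiter : ∀ n y, energy V (f^[n] y) = energy V y := by
    intro n
    induction n with
    | zero => simp
    | succ n ih => exact fun y => by rw [Function.iterate_succ_apply, ih, hf]
  have hsub : ∀ n y z, f^[n] (y - z) = f^[n] y - f^[n] z := fun n y z =>
    iterate_map_sub f n y z
  obtain ⟨ε, hε, hball⟩ := Metric.mem_nhds_iff.1 hU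
  have hbdd : Bornology.IsBounded {y : Phase N | energy V y = energy V x} := by
    refine isBounded_iff_forall_norm_le.2 ⟨√(energy V x / c), fun y hy => ?_⟩
    refine Real.le_sqrt_of_sq_le ?_
    rw [le_div_iff₀' hc]
    exact (hnorm y).trans_eq hy
  obtain ⟨y, -, φ, hφ, hlim⟩ := tendsto_subseq_of_bounded hbdd (x := fun n => f^[n] x)
    (fun n => hiter n x)
  have hdiff : Tendsto (fun k => energy V (f^[φ (k + 1)] x - f^[φ k] x)) atTop (𝓝 0) := by
    have h1 := (hlim.comp (tendsto_add_atTop_nat 1)).sub hlim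
    rw [sub_self] at h1
    simpa [Function.comp_def, energy_zero] using ((continuous_energy V).tendsto 0).comp h1
  obtain ⟨k, hk⟩ := (hdiff.eventually (gt_mem_nhds (show 0 < c * ε ^ 2 by positivity))).exists
  obtain ⟨n, hn⟩ := Nat.exists_eq_add_of_lt (hφ (Nat.lt_succ_self k))
  refine ⟨n, hball ?_⟩
  rw [Nat.succ_eq_add_one] at hn
  rw [hn, add_assoc, Function.iterate_add_apply, ← hsub, hiter] at hk
  have := (hnorm _).trans_lt hk
  rw [mem_ball_iff_norm]
  exact lt_of_pow_lt_pow_left₀ 2 hε.le (lt_of_mul_lt_mul_left this hc.le)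

/-- For a suitable even number `m`, all states near `x` reach all states near `y` at the `m`-th
flip, up to dilation. -/
def LocReach (V : Matrix (Fin N) (Fin N) ℝ) (x y : Phase N) : Prop :=
  ∃ m, Even m ∧ ∀ᶠ z in 𝓝 (x, y), RayReach V m z.1 z.2

lemma LocReach.trans {V : Matrix (Fin N) (Fin N) ℝ} {x y z : Phase N}
    (hxy : LocReach V x y) (hyz : LocReach V y z) : LocReach V x z := by
  obtain ⟨m, hm, h1⟩ := hxy
  obtain ⟨k, hk, h2⟩ := hyz
  refine ⟨m + k, hm.add hk, ?_⟩
  have h1' : ∀ᶠ x' in 𝓝 x, RayReach V m x' y :=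
    (Continuous.prodMk continuous_id continuous_const).tendsto' x (x, y) rfl |>.eventually h1
  have h2' : ∀ᶠ z' in 𝓝 z, RayReach V k y z' :=
    (Continuous.prodMk continuous_const continuous_id).tendsto' z (y, z) rfl |>.eventually h2
  rw [nhds_prod_eq]
  filter_upwards [h1'.prod_mk h2'] with w hw
  exact hw.1.trans hw.2

/-- The word that opens up all directions at `x` is followed by its own powers until its orbit
comes back near `x`. -/
lemma locReach_self {V : Matrix (Fin N) (Fin N) ℝ} (hV : V ∈ VPlus N) {x : Phase N} (hx : x ≠ 0) :
    LocReach V x x := by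
  have hsymm : Vᵀ = V := by simpa using hV.1.isHermitian.eq
  obtain ⟨m, τ, hτ, hloc⟩ := exists_eventually_rayReach hV hx
  obtain ⟨e, he⟩ := exists_equiv_stateAtFlip V τ
  rw [← he] at hloc
  have hen : ∀ y, energy V (e.symm y) = energy V y := fun y => by
    rw [← energy_stateAtFlip hsymm τ (e.symm y), ← he, e.apply_symm_apply]
  have hiter : ∀ j y, RayReach V (m * j) y (e^[j] y) := by
    intro j
    induction j with
    | zero => exact fun y => rayReach_self_of_even V (by simp) y
    | succ j ih =>
      intro y
      rw [Function.iterate_succ_apply', mul_add, mul_one]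
      exact (ih y).trans (he (e^[j] y) ▸ rayReach_stateAtFlip V hτ _)
  -- The backward orbit recurs as well; an even number of steps is taken to control the parity.
  let f : Phase N →L[ℝ] Phase N := (e.symm : Phase N →L[ℝ] Phase N) ∘L e.symm
  have hback : {y | ∀ᶠ z in 𝓝 (x, e y), RayReach V m z.1 z.2} ∈ 𝓝 x := by
    have hc : Continuous fun y => (x, e y) := by fun_prop
    exact hc.continuousAt.eventually (eventually_eventually_nhds.2 hloc)
  obtain ⟨n, hn⟩ := exists_iterate_mem_nhds hV.1 f (fun y => by simp [f, hen]) x hback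
  have hleft : ∀ y, e^[2 * n + 1] (e (f^[n + 1] y)) = y := by
    have h : Function.LeftInverse e^[2] f := fun y => by simp [f]
    intro y
    have := h.iterate (n + 1) y
    rw [← Function.iterate_mul] at this
    exact this
  refine ⟨m + m * (2 * n + 1), ⟨m * (n + 1), by ring⟩, ?_⟩
  have hcont : Continuous fun z : Phase N × Phase N => (z.1, e (f^[n + 1] z.2)) := by
    have := f.continuous.iterate (n + 1)
    fun_prop
  filter_upwards [hcont.continuousAt.eventually (show ∀ᶠ w in 𝓝 (x, e (f^[n + 1] x)), _ from hn)]
    with z hz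
  have := hz.trans (hiter (2 * n + 1) (e (f^[n + 1] z.2)))
  rwa [hleft] at this

lemma locReach {V : Matrix (Fin N) (Fin N) ℝ} (hV : V ∈ VPlus N) {x y : Phase N}
    (hx : x ≠ 0) (hy : y ≠ 0) : LocReach V x y := by
  have hrank : 1 < Module.rank ℝ (Phase N) := by
    have : 0 < N := Nat.pos_of_neZero N
    rw [← Module.finrank_eq_rank, Module.finrank_fintype_fun_eq_card, Fintype.card_sum,
      Fintype.card_fin]
    exact_mod_cast (by omega : 1 < N + N)
  have hconn := (isConnected_compl_singleton_of_one_lt_rank hrank (0 : Phase N)).isPreconnected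
  refine (hconn.induction₂' (fun x y => LocReach V x y) (fun z hz => ?_)
    (fun _ _ _ _ _ _ h1 h2 => h1.trans h2) hx hy)
  obtain ⟨m, hm, h⟩ := locReach_self hV hz
  have h' := eventually_eventually_nhds.2 h
  have h1 : ∀ᶠ w in 𝓝 z, LocReach V z w :=
    ((Continuous.prodMk continuous_const continuous_id).tendsto' z (z, z) rfl |>.eventually h').mono
      fun w hw => ⟨m, hm, hw⟩
  have h2 : ∀ᶠ w in 𝓝 z, LocReach V w z :=
    ((Continuous.prodMk continuous_id continuous_const).tendsto' z (z, z) rfl |>.eventually h').mono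
      fun w hw => ⟨m, hm, hw⟩
  exact mem_nhdsWithin_of_mem_nhds (h1.and h2)

/-- By compactness of the unit sphere a single number of flips serves all pairs of directions. -/
lemma exists_forall_rayReach {V : Matrix (Fin N) (Fin N) ℝ} (hV : V ∈ VPlus N) :
    ∃ m, 1 ≤ m ∧ ∀ x y : Phase N, x ≠ 0 → y ≠ 0 → RayReach V m x y := by
  have hcomp : IsCompact (Metric.sphere (0 : Phase N) 1 ×ˢ Metric.sphere (0 : Phase N) 1) :=
    (isCompact_sphere _ _).prod (isCompact_sphere _ _)
  obtain ⟨m, hm, h⟩ : ∃ m, Even m ∧ ∀ z ∈ Metric.sphere (0 : Phase N) 1 ×ˢ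
      Metric.sphere (0 : Phase N) 1, RayReach V m z.1 z.2 := by
    refine hcomp.induction_on (p := fun s => ∃ m, Even m ∧ ∀ z ∈ s, RayReach V m z.1 z.2)
      ⟨0, by simp⟩ ?_ ?_ ?_
    · rintro s t hst ⟨m, hm, h⟩
      exact ⟨m, hm, fun z hz => h z (hst hz)⟩
    · rintro s t ⟨m, hm, h⟩ ⟨k, hk, h'⟩
      refine ⟨m + k, hm.add hk, ?_⟩
      rintro z (hz | hz)
      · exact (h z hz).mono hk
      · exact add_comm k m ▸ (h' z hz).mono hm
    · rintro ⟨x, y⟩ ⟨hx, hy⟩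
      obtain ⟨m, hm, h⟩ := locReach hV (ne_zero_of_mem_unit_sphere ⟨x, hx⟩)
        (ne_zero_of_mem_unit_sphere ⟨y, hy⟩)
      exact ⟨_, mem_nhdsWithin_of_mem_nhds h, m, hm, fun z hz => hz⟩
  refine ⟨m + 2, by omega, fun x y hx hy => RayReach.mono ?_ even_two⟩
  have hx' : ‖x‖ ≠ 0 := norm_ne_zero_iff.2 hx
  have hy' : ‖y‖ ≠ 0 := norm_ne_zero_iff.2 hy
  obtain ⟨r, hr, τ, hτ, hrτ⟩ := h (‖x‖⁻¹ • x, ‖y‖⁻¹ • y)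
    ⟨by simp [norm_smul, hx'], by simp [norm_smul, hy']⟩
  refine ⟨‖y‖ * (r * ‖x‖⁻¹), by positivity, τ, hτ, ?_⟩
  rw [mul_smul, mul_smul, ← stateAtFlip_smul, ← hrτ, smul_inv_smul₀ hy']

end VelocityFlip

theorem theorem1 (N : ℕ) [NeZero N] (V : Matrix (Fin N) (Fin N) ℝ)
    (hV : V ∈ VelocityFlip.VPlus N ∩ VelocityFlip.VInd N) :
    ∃ m : ℕ, 1 ≤ m ∧ ∀ ψ : VelocityFlip.Phase N,
      VelocityFlip.reachable V m ψ =
        VelocityFlip.energySurface V (VelocityFlip.energy V ψ) := by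
  obtain ⟨hVp, -⟩ := hV
  have hsymm : Vᵀ = V := by simpa using hVp.1.isHermitian.eq
  have hpos := fun {x : VelocityFlip.Phase N} => VelocityFlip.energy_pos hVp.1 (x := x)
  obtain ⟨m, hm, hreach⟩ := VelocityFlip.exists_forall_rayReach hVp
  refine ⟨m, hm, fun ψ => Set.Subset.antisymm ?_ fun φ hφ => ?_⟩
  · rintro _ ⟨τ, -, rfl⟩
    exact VelocityFlip.energy_stateAtFlip hsymm τ ψ
  · replace hφ : VelocityFlip.energy V φ = VelocityFlip.energy V ψ := hφ
    by_cases hψ0 : ψ = 0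
    · -- The energy surface of the rest state is the rest state itself.
      subst hψ0
      rw [VelocityFlip.energy_zero] at hφ
      have hφ0 : φ = 0 := by
        by_contra h
        exact (hpos h).ne' hφ
      obtain ⟨e, he⟩ := VelocityFlip.exists_equiv_stateAtFlip V (fun _ : Fin m => (0 : ℝ))
      exact ⟨fun _ => 0, fun _ => le_rfl, by rw [← he, map_zero, hφ0]⟩
    · have hφ0 : φ ≠ 0 := by
        rintro rfl
        rw [VelocityFlip.energy_zero] at hφ
        exact (hpos hψ0).ne hφ
      obtain ⟨r, hr, τ, hτ, rfl⟩ := hreach ψ φ hψ0 hφ0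
      rw [VelocityFlip.energy_smul, VelocityFlip.energy_stateAtFlip hsymm] at hφ
      have hr1 : r = 1 := by
        have := mul_right_cancel₀ (hpos hψ0).ne' (hφ.trans (one_mul _).symm)
        exact (pow_eq_one_iff_of_nonneg hr.le two_ne_zero).1 this
      exact ⟨τ, hτ, by rw [hr1, one_smul]⟩
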